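/- Let $M,d,j,k$ be fixed non-negative integers with $1\le d<M$, or with $d=M\ge 1$ and $j=0$. For $N\ge\max(j,k)$ let $(N^d,j)$ be the partition with $d$ parts equal to $N$ followed by one part $j$, and let $s_{(N^d,j)/(k)}(1^M)$ be the skew Schur polynomial in $M$ variables with all variables set equal to $1$; here $s_{\mu/\nu}=\det\left(h_{\mu_a-\nu_b-a+b}\right)_{a,b=1}^{n}$ for any $n$ that is at least the lengths of $\mu$ and $\nu$, where $h_m$ are the complete homogeneous symmetric polynomials ($h_m=0$ for $m<0$). Let $G$ be the Barnes function, so that $G(n)=\prod_{i=0}^{n-2} i!$ for integers $n\ge 1$, and let $\binom{a}{n}=a(a-1)\cdots(a-n+1)/n!$ for integers $a$ and $n\ge0$ (so $\binom{-1}{0}=1$). Then, as $N\to\infty$, $$ s_{(N^d,j)/(k)}(1^M)\;\sim\; N^{d(M-d)}\,\frac{G(d+1)\,G(M-d+1)}{G(M+1)}\sum_{r=0}^{\min(j,k)}\binom{M-d+j-r-1}{j-r}\binom{d+k-r-1}{k-r}. $$ The same asymptotic formula, with the same right-hand side, holds as $N\to\infty$ for the Selberg–Morris integral with $\gamma=M-d$,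 $\delta=d$ and two elementary symmetric polynomials inserted, $$ \frac{1}{N!\,(2\pi)^N}\int_{[-\pi,\pi]^N} e_k(e^{i\theta_1},\dots,e^{i\theta_N})\,e_j(e^{-i\theta_1},\dots,e^{-i\theta_N})\prod_{l=1}^{N}e^{\frac12 i\theta_l(\gamma-\delta)}\,|1+e^{i\theta_l}|^{\gamma+\delta}\prod_{1\le a<b\le N}|e^{i\theta_a}-e^{i\theta_b}|^2\,d\theta_1\cdots d\theta_N . $$ Here $f\sim g$ means that $f(N)/g(N)\to1$. -/

import Mathlib

open Filter Asymptotics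

namespace SkewSchurAsymptotics

/-- The complete homogeneous symmetric polynomial `h_n` in the variables indexed by `σ`, for an
integer index `n`, with `h_n = 0` for `n < 0`. -/
noncomputable def completeHomogeneous (σ R : Type*) [CommRing R] [Fintype σ] [DecidableEq σ]
    (n : ℤ) : MvPolynomial σ R :=
  if 0 ≤ n then MvPolynomial.hsymm σ R n.toNat else 0

/-- The skew Schur polynomial `s_{μ/ν}` in the variables indexed by `σ`, by the Jacobi-Trudi
formula `s_{μ/ν} = det (h_{μ_a - ν_b - a + b})`. A partition is given by the weakly decreasing
list of its parts; trailing zeros are allowed and parts beyond the end of the list are zero. -/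
noncomputable def skewSchur (σ R : Type*) [CommRing R] [Fintype σ] [DecidableEq σ]
    (μ ν : List ℕ) : MvPolynomial σ R :=
  Matrix.det (Matrix.of fun a b : Fin (max μ.length ν.length) =>
    completeHomogeneous σ R
      ((μ.getD a 0 : ℤ) - (ν.getD b 0 : ℤ) - ((a : ℕ) : ℤ) + ((b : ℕ) : ℤ)))

/-- The partition `(N, …, N, j)` with `d` entries `N` followed by one entry `j` (for `j ≤ N`). -/
def rectWithRow (N d j : ℕ) : List ℕ := List.replicate d N ++ [j]

/-- The Barnes function at the positive integers: `G(n) = 0! 1! ⋯ (n-2)!`, that is, `G(1) = 1`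
and `G(n+1) = Γ(n) G(n)`. -/
def barnesG (n : ℕ) : ℕ := ∏ i ∈ Finset.range (n - 1), i.factorial

/-- The weight `e^{iθ(γ-δ)/2} |1 + e^{iθ}|^{γ+δ}` of the Morris integral. For `-π < θ < π` it is
the pure Fisher-Hartwig symbol `(1 + e^{iθ})^γ (1 + e^{-iθ})^δ`. -/
noncomputable def morrisWeight (γ δ : ℕ) (θ : ℝ) : ℂ :=
  Complex.exp (Complex.I * θ * ((γ : ℂ) - δ) / 2) *
    ((‖1 + Complex.exp (Complex.I * θ)‖ ^ (γ + δ) : ℝ) : ℂ)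

/-- The Selberg-Morris integral over `[-π, π]^N` with the insertion of the elementary symmetric
polynomials `e_k(e^{iθ_1}, …, e^{iθ_N})` and `e_j(e^{-iθ_1}, …, e^{-iθ_N})`. -/
noncomputable def morrisIntegral (N γ δ k j : ℕ) : ℂ :=
  1 / ((N.factorial : ℂ) * (2 * (Real.pi : ℂ)) ^ N) *
    ∫ θ in Set.Icc (fun _ : Fin N => -Real.pi) (fun _ : Fin N => Real.pi),
      MvPolynomial.eval (fun l => Complex.exp (Complex.I * (θ l : ℂ)))
          (MvPolynomial.esymm (Fin N) ℂ k) *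
        MvPolynomial.eval (fun l => Complex.exp (-(Complex.I * (θ l : ℂ))))
          (MvPolynomial.esymm (Fin N) ℂ j) *
        (∏ l : Fin N, morrisWeight γ δ (θ l)) *
        ((∏ p : Fin N × Fin N with p.1 < p.2,
          ‖Complex.exp (Complex.I * (θ p.1 : ℂ)) - Complex.exp (Complex.I * (θ p.2 : ℂ))‖ ^ 2 : ℝ) :
            ℂ)

end SkewSchurAsymptotics

/-!
Write `M = g + d`. By the dual Jacobi–Trudi identity, the skew Schur polynomial at ones is the minor
of the `(N + 1) × (N + 1)` Toeplitz matrix `T` with symbol `(1 + X) ^ (g + d)`, shifted by `d`, that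
omits one row and one column. By Andréief's identity the Morris integral is the same minor: an
elementary symmetric polynomial times a Vandermonde determinant is a determinant with one power
omitted, and the integrals of the weight against exponentials are the entries of `T`. Up to diagonal
factors, `T` is a product of a lower and an upper unitriangular Toeplitz matrix, so `det T` and the
entries of `T⁻¹`, hence the minor, are explicit sums of products of rising factorials, from which
the asymptotics are read off.
-/

namespace SkewSchurAsymptotics

section Toeplitz

open PowerSeries Matrix Finset

variable {R : Type*} [CommRing R]

/-- The `n × n` Toeplitz matrix with `(a, b)` entry the coefficient of `X ^ (s + a - b)` in `f`,
read as `0` when `s + a < b`. Shifting `f` by `X ^ b` keeps the index in `ℕ`. -/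
noncomputable def toeplitz (f : R⟦X⟧) (s n : ℕ) : Matrix (Fin n) (Fin n) R :=
  of fun a b => coeff (s + a) (X ^ (b : ℕ) * f)

lemma toeplitz_apply (f : R⟦X⟧) (s n : ℕ) (a b : Fin n) :
    toeplitz f s n a b = coeff (s + a) (X ^ (b : ℕ) * f) := rfl

lemma coeff_mul_eq_sum_range (f g : R⟦X⟧) {a n : ℕ} (ha : a < n) :
    coeff a (f * g) = ∑ m ∈ range n, coeff a (X ^ m * f) * coeff m g := by
  rw [mul_comm f g, coeff_mul, Nat.sum_antidiagonal_eq_sum_range_succ_mk]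
  symm
  refine (sum_subset (range_subset_range.2 ha) fun m _ hm => ?_).symm.trans
    (sum_congr rfl fun m hm => ?_)
  · rw [coeff_X_pow_mul', if_neg (by simpa using hm), zero_mul]
  · rw [coeff_X_pow_mul', if_pos (mem_range_succ_iff.1 hm), mul_comm]

lemma toeplitz_mul_toeplitz (f g : R⟦X⟧) (n : ℕ) :
    toeplitz f 0 n * toeplitz g 0 n = toeplitz (f * g) 0 n := by
  ext a b
  simp only [mul_apply, toeplitz_apply, zero_add]
  rw [Fin.sum_univ_eq_sum_range fun m => coeff a (X ^ m * f) * coeff m (X ^ (b : ℕ) * g),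
    ← coeff_mul_eq_sum_range f _ a.isLt, mul_left_comm]

lemma toeplitz_one (n : ℕ) : toeplitz (1 : R⟦X⟧) 0 n = 1 := by
  ext a b
  simp [toeplitz_apply, coeff_X_pow, Matrix.one_apply, Fin.ext_iff]

lemma toeplitz_mul_toeplitz_eq_one {f g : R⟦X⟧} (hfg : f * g = 1) (n : ℕ) :
    toeplitz f 0 n * toeplitz g 0 n = 1 := by
  rw [toeplitz_mul_toeplitz, hfg, toeplitz_one]

lemma det_toeplitz_zero (f : R⟦X⟧) (n : ℕ) :
    (toeplitz f 0 n).det = constantCoeff f ^ n := by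
  rw [det_of_isLowerTriangular]
  · simp [toeplitz_apply, coeff_X_pow_mul']
  · intro a b hab
    have hlt : (a : ℕ) < b := hab
    simp [toeplitz_apply, coeff_X_pow_mul', hlt.not_ge]

lemma coeff_X_pow_mul_rescale_neg_one (f : R⟦X⟧) (m b : ℕ) :
    coeff m (X ^ b * rescale (-1) f) = (-1) ^ (m + b) * coeff m (X ^ b * f) := by
  rw [coeff_X_pow_mul', coeff_X_pow_mul']
  split_ifs with h
  · obtain ⟨c, rfl⟩ := Nat.exists_eq_add_of_le h
    rw [coeff_rescale, show b + c + b = c + 2 * b by ring, pow_add, pow_mul]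
    simp
  · simp

lemma coeff_one_add_X_pow (m n : ℕ) : coeff n ((1 + X : R⟦X⟧) ^ m) = m.choose n := by
  rw [← Polynomial.coeff_one_add_X_pow, ← Polynomial.coeff_coe]
  simp

lemma coeff_invOneSubPow (m n : ℕ) : coeff n (invOneSubPow R m).val = m.multichoose n := by
  rcases m with _ | m
  · rcases n with _ | n <;> simp [invOneSubPow_zero, coeff_one]
  · rw [invOneSubPow_val_succ_eq_mk_add_choose, coeff_mk, Nat.multichoose_eq,
      Nat.choose_symm_add, add_right_comm, Nat.add_sub_cancel]

lemma one_add_X_pow_mul_rescale_invOneSubPow (m : ℕ) :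
    (1 + X : R⟦X⟧) ^ m * rescale (-1) (invOneSubPow R m).val = 1 := by
  have hX : (1 + X : R⟦X⟧) = rescale (-1) (1 - X) := by simp
  rw [hX, ← map_pow, ← map_mul, ← invOneSubPow_inv_eq_one_sub_pow, Units.inv_val, map_one]

end Toeplitz

section Binomial

open Finset

lemma add_choose_eq_sum_range (m n k : ℕ) :
    (m + n).choose k = ∑ t ∈ range (min m k + 1), m.choose t * n.choose (k - t) := by
  rw [Nat.add_choose_eq, Nat.sum_antidiagonal_eq_sum_range_succ_mk]
  symm
  refine sum_subset (range_subset_range.2 (by omega)) fun t ht hmt => ?_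
  simp only [mem_range] at ht hmt
  rw [Nat.choose_eq_zero_of_lt (by omega), zero_mul]

lemma choose_sub_mul_choose_add_eq_sum_range (g d : ℕ) {a r : ℕ} (hr : r ≤ a) :
    g.choose (a - r) * (g + d + r).choose r =
      ∑ s ∈ range (r + 1), (d + a).choose s * (g.choose (a - s) * (a - s).choose (r - s)) := by
  rcases lt_or_ge g (a - r) with hg | hg
  · rw [Nat.choose_eq_zero_of_lt hg, zero_mul, sum_eq_zero]
    intro s hs
    have hsr : s ≤ r := mem_range_succ_iff.1 hs
    rw [Nat.choose_eq_zero_of_lt (show g < a - s by omega), zero_mul, mul_zero]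
  · rw [show g + d + r = d + a + (g - (a - r)) by omega, add_choose_eq_sum_range,
      min_eq_right (by omega), mul_sum]
    refine sum_congr rfl fun s hs => ?_
    have hsr : s ≤ r := mem_range_succ_iff.1 hs
    rw [← Nat.choose_symm (show r - s ≤ a - s by omega), Nat.choose_mul (by omega),
      show a - s - (r - s) = a - r by omega, show a - s - (a - r) = r - s by omega]
    ring

lemma sum_choose_mul_choose_mul_choose (g d a b : ℕ) :
    ∑ r ∈ range (min a b + 1), g.choose (a - r) * d.choose (b - r) * (g + d + r).choose r =
      (d + a).choose b * (g + b).choose a := by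
  have collapse {s : ℕ} (hs : s ≤ min a b) :
      ∑ r ∈ Ico s (min a b + 1), (a - s).choose (r - s) * d.choose (b - r) =
        (d + a - s).choose (b - s) := by
    rw [sum_Ico_eq_sum_range, show d + a - s = a - s + d by omega, add_choose_eq_sum_range,
      show min a b + 1 - s = min (a - s) (b - s) + 1 by omega]
    simp only [Nat.add_sub_cancel_left, Nat.sub_sub]
  calc
    _ = ∑ r ∈ Ico 0 (min a b + 1), ∑ s ∈ Ico 0 (r + 1), (d + a).choose s *
          g.choose (a - s) * ((a - s).choose (r - s) * d.choose (b - r)) := by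
      rw [← range_eq_Ico]
      refine sum_congr rfl fun r hr => ?_
      have hra : r ≤ a := by grind
      rw [mul_right_comm, choose_sub_mul_choose_add_eq_sum_range g d hra, ← range_eq_Ico, sum_mul]
      exact sum_congr rfl fun s _ => by ring
    _ = ∑ s ∈ range (min a b + 1), (d + a).choose s * g.choose (a - s) *
          (d + a - s).choose (b - s) := by
      rw [← sum_Ico_Ico_comm, ← range_eq_Ico]
      refine sum_congr rfl fun s hs => ?_
      rw [← mul_sum, collapse (mem_range_succ_iff.1 hs)]
    _ = (d + a).choose b * (g + b).choose a := by
      rw [add_comm g b, add_choose_eq_sum_range b g a, mul_sum, min_comm]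
      refine sum_congr rfl fun s hs => ?_
      rw [← mul_assoc, Nat.choose_mul (show s ≤ b by grind)]
      ring

lemma ascFactorial_mul_choose_mul_ascFactorial (g d a b : ℕ) (hb : b ≤ d + a) :
    (a + 1).ascFactorial d * (g + d).choose (d + a - b) * (b + 1).ascFactorial g =
      (g + d).factorial * ((d + a).choose b * (g + b).choose a) := by
  rcases lt_or_ge (g + b) a with ha | ha
  · rw [Nat.choose_eq_zero_of_lt ha, Nat.choose_eq_zero_of_lt (by omega)]
    simp
  · have hgd := Nat.choose_mul_factorial_mul_factorial (show d + a - b ≤ g + d by omega)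
    have hda := Nat.choose_mul_factorial_mul_factorial hb
    have hgb := Nat.choose_mul_factorial_mul_factorial ha
    rw [show g + d - (d + a - b) = g + b - a by omega] at hgd
    have had := Nat.factorial_mul_ascFactorial a d
    have hbg := Nat.factorial_mul_ascFactorial b g
    have hpos : 0 < a.factorial * b.factorial * (d + a - b).factorial * (g + b - a).factorial := by
      positivity
    refine Nat.eq_of_mul_eq_mul_left hpos ?_
    calc
      _ = (a.factorial * (a + 1).ascFactorial d) * (b.factorial * (b + 1).ascFactorial g) *
          ((g + d).choose (d + a - b) * (d + a - b).factorial * (g + b - a).factorial) := by ring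
      _ = ((d + a).choose b * b.factorial * (d + a - b).factorial) *
          ((g + b).choose a * a.factorial * (g + b - a).factorial) * (g + d).factorial := by
        rw [had, hbg, hgd, hda, hgb, add_comm a d, add_comm b g]
      _ = _ := by ring

lemma ringChoose_eq_multichoose (m : ℕ) {n r : ℕ} (hr : r ≤ n) :
    Ring.choose ((m : ℤ) + n - r - 1) (n - r) = m.multichoose (n - r) := by
  rw [Nat.multichoose_eq, add_sub_assoc (m : ℤ), ← Nat.cast_sub hr, ← Ring.multichoose_eq]
  rfl

end Binomial

section Factorization

open PowerSeries Matrix Finset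

/-- The diagonal matrix with entries the rising factorials `(a + 1)(a + 2)⋯(a + m)`, the diagonal
factor in the triangular factorization of binomial Toeplitz matrices. -/
def ascDiagonal (R : Type*) [CommRing R] (m n : ℕ) : Matrix (Fin n) (Fin n) R :=
  diagonal fun a => ((a + 1 : ℕ).ascFactorial m : R)

lemma sum_coeff_mul_ascFactorial_mul_coeff (R : Type*) [CommRing R] (g d : ℕ) {a b n : ℕ}
    (ha : a < n) :
    ∑ r ∈ range n, coeff a (X ^ r * (1 + X : R⟦X⟧) ^ g) * ((r + 1).ascFactorial (g + d) : R) *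
        coeff b (X ^ r * (1 + X : R⟦X⟧) ^ d) =
      ((g + d).factorial * ((d + a).choose b * (g + b).choose a) : ℕ) := by
  have term (r : ℕ) :
      coeff a (X ^ r * (1 + X : R⟦X⟧) ^ g) * ((r + 1).ascFactorial (g + d) : R) *
          coeff b (X ^ r * (1 + X : R⟦X⟧) ^ d) =
        if r < min a b + 1 then ((g + d).factorial : R) *
          (g.choose (a - r) * d.choose (b - r) * (g + d + r).choose r : ℕ) else 0 := by
    simp only [coeff_X_pow_mul', coeff_one_add_X_pow]
    split_ifs <;> try omega
    · rw [Nat.ascFactorial_eq_factorial_mul_choose, ← Nat.choose_symm_add, add_comm r]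
      push_cast
      ring
    all_goals simp
  simp only [term, ← sum_choose_mul_choose_mul_choose, ← sum_filter]
  rw [← mul_sum, show (range n).filter (· < min a b + 1) = range (min a b + 1) by grind]
  push_cast
  rfl

theorem ascDiagonal_mul_toeplitz_mul_ascDiagonal (R : Type*) [CommRing R] (g d n : ℕ) :
    ascDiagonal R d n * toeplitz ((1 + X) ^ (g + d)) d n * ascDiagonal R g n =
      toeplitz ((1 + X) ^ g) 0 n * ascDiagonal R (g + d) n * (toeplitz ((1 + X) ^ d) 0 n)ᵀ := by
  ext a b
  rw [ascDiagonal, ascDiagonal, mul_diagonal, diagonal_mul, mul_apply]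
  simp only [ascDiagonal, mul_diagonal, transpose_apply, toeplitz_apply, zero_add]
  rw [Fin.sum_univ_eq_sum_range fun r => coeff a (X ^ r * (1 + X : R⟦X⟧) ^ g) *
      ((r + 1).ascFactorial (g + d) : R) * coeff b (X ^ r * (1 + X : R⟦X⟧) ^ d),
    sum_coeff_mul_ascFactorial_mul_coeff R g d a.isLt, coeff_X_pow_mul', coeff_one_add_X_pow]
  split_ifs with h
  · rw [← ascFactorial_mul_choose_mul_ascFactorial g d a b h]
    push_cast
    rfl
  · rw [Nat.choose_eq_zero_of_lt (not_le.1 h)]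
    simp

lemma det_ascDiagonal (R : Type*) [CommRing R] (m n : ℕ) :
    (ascDiagonal R m n).det = ∏ a ∈ range n, ((a + 1).ascFactorial m : R) := by
  rw [ascDiagonal, det_diagonal, Fin.prod_univ_eq_prod_range fun a => ((a + 1).ascFactorial m : R)]

lemma det_ascDiagonal_mul_det_toeplitz (R : Type*) [CommRing R] (g d n : ℕ) :
    (ascDiagonal R d n).det * (toeplitz ((1 + X : R⟦X⟧) ^ (g + d)) d n).det *
      (ascDiagonal R g n).det = (ascDiagonal R (g + d) n).det := by
  have hdet := congrArg det (ascDiagonal_mul_toeplitz_mul_ascDiagonal R g d n)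
  simpa [det_toeplitz_zero] using hdet

variable (K : Type*) [Field K] [CharZero K]

lemma isUnit_det_ascDiagonal (m n : ℕ) : IsUnit (ascDiagonal K m n).det := by
  rw [det_ascDiagonal, isUnit_iff_ne_zero, prod_ne_zero_iff]
  exact fun a _ => Nat.cast_ne_zero.2 (Nat.ascFactorial_pos _ _).ne'

lemma isUnit_det_toeplitz_one_add_X_pow (g d n : ℕ) :
    IsUnit (toeplitz ((1 + X : K⟦X⟧) ^ (g + d)) d n).det := by
  have hunit := isUnit_det_ascDiagonal K (g + d) n
  rw [← det_ascDiagonal_mul_det_toeplitz] at hunit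
  exact isUnit_of_mul_isUnit_right (isUnit_of_mul_isUnit_left hunit)

theorem inv_toeplitz_one_add_X_pow (g d n : ℕ) :
    (toeplitz ((1 + X : K⟦X⟧) ^ (g + d)) d n)⁻¹ =
      ascDiagonal K g n * ((toeplitz (rescale (-1) (invOneSubPow K d).val) 0 n)ᵀ *
        (ascDiagonal K (g + d) n)⁻¹ * toeplitz (rescale (-1) (invOneSubPow K g).val) 0 n) *
          ascDiagonal K d n := by
  have inv_lower (m : ℕ) : (toeplitz ((1 + X : K⟦X⟧) ^ m) 0 n)⁻¹ =
      toeplitz (rescale (-1) (invOneSubPow K m).val) 0 n :=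
    inv_eq_right_inv (toeplitz_mul_toeplitz_eq_one (one_add_X_pow_mul_rescale_invOneSubPow m) n)
  have hinv := congrArg Inv.inv (ascDiagonal_mul_toeplitz_mul_ascDiagonal K g d n)
  simp only [Matrix.mul_inv_rev, ← transpose_nonsing_inv, inv_lower, ← mul_assoc] at hinv
  rw [← hinv, mul_assoc (ascDiagonal K g n)⁻¹,
    mul_nonsing_inv_cancel_left _ _ (isUnit_det_ascDiagonal K g n),
    nonsing_inv_mul_cancel_right _ _ (isUnit_det_ascDiagonal K d n)]

end Factorization

section Minor

open PowerSeries Matrix Finset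

/-- The minor of the binomial Toeplitz matrix of size `N + 1` that omits row `N - j` and column
`N - k`. Both the skew Schur polynomial at ones and the Morris integral equal it. -/
noncomputable def toeplitzMinor (R : Type*) [CommRing R] (g d : ℕ) {N : ℕ} (j k : Fin (N + 1)) :
    R :=
  ((toeplitz ((1 + X : R⟦X⟧) ^ (g + d)) d (N + 1)).submatrix j.rev.succAbove k.rev.succAbove).det

lemma det_submatrix_succAbove {R : Type*} [CommRing R] {n : ℕ}
    (A : Matrix (Fin (n + 1)) (Fin (n + 1)) R) (p q : Fin (n + 1)) :
    (A.submatrix q.succAbove p.succAbove).det = (-1) ^ (q + p : ℕ) * A.adjugate p q := by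
  rw [adjugate_fin_succ_eq_det_submatrix, ← mul_assoc, ← mul_pow]
  simp

lemma adjugate_eq_det_smul_inv {n R : Type*} [Fintype n] [DecidableEq n] [CommRing R]
    {A : Matrix n n R} (hA : IsUnit A.det) : A.adjugate = A.det • A⁻¹ := by
  rw [Matrix.inv_def, smul_smul, Ring.mul_inverse_cancel _ hA, one_smul]

lemma coeff_sub_X_pow_sub_mul_invOneSubPow (R : Type*) [CommRing R] {N i r : ℕ} (hi : i ≤ N)
    (hr : r ≤ N) (m : ℕ) :
    coeff (N - r) (X ^ (N - i) * (invOneSubPow R m).val) =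
      if r ≤ i then (m.multichoose (i - r) : R) else 0 := by
  rw [coeff_X_pow_mul', coeff_invOneSubPow, show N - r - (N - i) = i - r by omega]
  exact if_congr (by omega) rfl rfl

variable (K : Type*) [Field K] [CharZero K]

lemma inv_ascDiagonal (m n : ℕ) :
    (ascDiagonal K m n)⁻¹ = diagonal fun a : Fin n => ((a + 1 : ℕ).ascFactorial m : K)⁻¹ := by
  refine inv_eq_right_inv ?_
  rw [ascDiagonal, diagonal_mul_diagonal, ← diagonal_one]
  congr with a
  exact mul_inv_cancel₀ (Nat.cast_ne_zero.2 (Nat.ascFactorial_pos _ _).ne')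

lemma inv_toeplitz_one_add_X_pow_apply (g d : ℕ) {n : ℕ} (p q : Fin n) :
    (toeplitz ((1 + X : K⟦X⟧) ^ (g + d)) d n)⁻¹ p q =
      (-1) ^ (q + p : ℕ) * ∑ m ∈ range n,
        ((p + 1 : ℕ).ascFactorial g : K) * (q + 1 : ℕ).ascFactorial d /
          (m + 1).ascFactorial (g + d) *
            (coeff m (X ^ (q : ℕ) * (invOneSubPow K g).val) *
              coeff m (X ^ (p : ℕ) * (invOneSubPow K d).val)) := by
  rw [inv_toeplitz_one_add_X_pow, inv_ascDiagonal, ascDiagonal, ascDiagonal, mul_diagonal,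
    diagonal_mul, mul_apply]
  simp only [mul_diagonal, transpose_apply, toeplitz_apply, zero_add,
    coeff_X_pow_mul_rescale_neg_one]
  rw [Fin.sum_univ_eq_sum_range fun m : ℕ => (-1 : K) ^ (m + p : ℕ) *
      coeff m (X ^ (p : ℕ) * (invOneSubPow K d).val) * ((m + 1).ascFactorial (g + d) : K)⁻¹ *
      ((-1) ^ (m + q : ℕ) * coeff m (X ^ (q : ℕ) * (invOneSubPow K g).val)),
    mul_sum, sum_mul, mul_sum]
  refine sum_congr rfl fun m _ => ?_
  have hsign : (-1 : K) ^ (m + p : ℕ) * (-1) ^ (m + q : ℕ) = (-1) ^ (q + p : ℕ) := by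
    rw [← pow_add, show m + p + (m + q) = (q + p + 2 * m : ℕ) by ring, pow_add, pow_mul]
    simp
  rw [← hsign]
  ring

theorem toeplitzMinor_eq_det_mul_sum (g d : ℕ) {N : ℕ} (j k : Fin (N + 1)) :
    toeplitzMinor K g d j k = (toeplitz ((1 + X : K⟦X⟧) ^ (g + d)) d (N + 1)).det *
      ∑ r ∈ range (min (j : ℕ) k + 1),
        ((N - k + 1 : ℕ).ascFactorial g : K) * (N - j + 1 : ℕ).ascFactorial d /
          (N - r + 1).ascFactorial (g + d) *
            (g.multichoose (j - r) * d.multichoose (k - r)) := by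
  have hval (i : Fin (N + 1)) : (i.rev : ℕ) = N - i := by simp [Fin.val_rev]
  rw [toeplitzMinor, det_submatrix_succAbove, adjugate_eq_det_smul_inv
    (isUnit_det_toeplitz_one_add_X_pow K g d _), Matrix.smul_apply, smul_eq_mul,
    inv_toeplitz_one_add_X_pow_apply, mul_left_comm, ← mul_assoc ((-1) ^ _), ← mul_pow,
    neg_one_mul, neg_neg, one_pow, one_mul, hval, hval, ← sum_range_reflect]
  congr 1
  symm
  refine (sum_congr rfl fun r hr => ?_).trans
    (sum_subset (range_subset_range.2 (by omega)) fun r hr hmin => ?_)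
  all_goals
    rw [add_tsub_cancel_right, coeff_sub_X_pow_sub_mul_invOneSubPow K j.is_le (by grind),
      coeff_sub_X_pow_sub_mul_invOneSubPow K k.is_le (by grind)]
  · rw [if_pos (by grind), if_pos (by grind)]
  · rcases lt_or_ge (j : ℕ) r with hjr | hjr
    · rw [if_neg hjr.not_ge, zero_mul, mul_zero]
    · rw [if_neg (c := r ≤ (k : ℕ)) (by grind), mul_zero, mul_zero]

end Minor

section ComplementaryMinor

open Matrix

variable {R m n κ : Type*} [CommRing R] [Fintype m] [Fintype n] [Fintype κ]
  [DecidableEq m] [DecidableEq n] [DecidableEq κ] {A B : Matrix (n ⊕ m) (n ⊕ m) R}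

lemma blocks_mul_eq_one (h : A * B = 1) :
    A.toBlocks₁₁ * B.toBlocks₁₁ + A.toBlocks₁₂ * B.toBlocks₂₁ = 1 ∧
      A.toBlocks₁₁ * B.toBlocks₁₂ + A.toBlocks₁₂ * B.toBlocks₂₂ = 0 ∧
      A.toBlocks₂₁ * B.toBlocks₁₁ + A.toBlocks₂₂ * B.toBlocks₂₁ = 0 ∧
      A.toBlocks₂₁ * B.toBlocks₁₂ + A.toBlocks₂₂ * B.toBlocks₂₂ = 1 := by
  rwa [← fromBlocks_toBlocks A, ← fromBlocks_toBlocks B, fromBlocks_multiply, ← fromBlocks_one,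
    fromBlocks_inj] at h

lemma det_mul_det_toBlocks₁₁ (h : A * B = 1) :
    A.det * B.toBlocks₁₁.det = A.toBlocks₂₂.det := by
  obtain ⟨h₁₁, -, h₂₁, -⟩ := blocks_mul_eq_one h
  have hmul : A * fromBlocks B.toBlocks₁₁ 0 B.toBlocks₂₁ 1 =
      fromBlocks 1 A.toBlocks₁₂ 0 A.toBlocks₂₂ := by
    conv_lhs => rw [← fromBlocks_toBlocks A]
    rw [fromBlocks_multiply, h₁₁, h₂₁]
    simp
  simpa using congrArg det hmul

/-- Jacobi's identity for complementary minors, with the complementary minor of `A` written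
through the inverse of the block `A₂₂`. -/
theorem det_mul_det_submatrix_sumMap (h : A * B = 1) (hA : IsUnit A.toBlocks₂₂.det) (i j : κ → m) :
    A.det * (B.submatrix (Sum.map id i) (Sum.map id j)).det =
      A.toBlocks₂₂.det * (A.toBlocks₂₂⁻¹.submatrix i j).det := by
  obtain ⟨-, -, h₂₁, h₂₂⟩ := blocks_mul_eq_one h
  have hdet := det_mul_det_toBlocks₁₁ h
  have hB : IsUnit B.toBlocks₁₁.det := isUnit_of_mul_isUnit_right (hdet ▸ hA)
  have schur_complement :
      A.toBlocks₂₂⁻¹ = B.toBlocks₂₂ - B.toBlocks₂₁ * B.toBlocks₁₁⁻¹ * B.toBlocks₁₂ := by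
    refine inv_eq_right_inv ?_
    rw [Matrix.mul_sub, ← Matrix.mul_assoc, ← Matrix.mul_assoc, ← neg_eq_of_add_eq_zero_right h₂₁,
      Matrix.neg_mul, mul_nonsing_inv_cancel_right _ _ hB, Matrix.neg_mul, sub_neg_eq_add, add_comm,
      h₂₂]
  have hsub : B.submatrix (Sum.map id i) (Sum.map id j) =
      fromBlocks B.toBlocks₁₁ (B.toBlocks₁₂.submatrix id j) (B.toBlocks₂₁.submatrix i id)
        (B.toBlocks₂₂.submatrix i j) := by
    ext (a | a) (b | b) <;> rfl
  let _ := invertibleOfIsUnitDet _ hB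
  rw [hsub, det_fromBlocks₁₁, invOf_eq_nonsing_inv, ← mul_assoc, hdet, schur_complement]
  rfl

end ComplementaryMinor

section DualJacobiTrudi

open Matrix PowerSeries Finset

variable {R : Type*} [CommRing R]

lemma det_submatrix_equiv_equiv {m n : Type*} [Fintype m] [Fintype n] [DecidableEq m]
    [DecidableEq n] (A : Matrix m m R) (e₁ e₂ : n ≃ m) :
    (A.submatrix e₁ e₂).det = Equiv.Perm.sign (e₂.symm.trans e₁) * A.det := by
  rw [← det_permute, ← det_submatrix_equiv_self e₂, submatrix_submatrix]
  congr 2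
  ext a
  simp

lemma det_neg_one_pow_add_mul {n : Type*} [Fintype n] [DecidableEq n] (A : Matrix n n R)
    (r c : n → ℕ) :
    (of fun a b => (-1) ^ (r a + c b) * A a b).det =
      (-1) ^ (∑ a, r a + ∑ b, c b) * A.det := by
  simp only [pow_add, mul_assoc]
  rw [← prod_pow_eq_pow_sum, ← prod_pow_eq_pow_sum, ← det_mul_row, ← det_mul_column]
  rfl

lemma val_finRotate_pow_apply (n m : ℕ) (i : Fin (n + 1)) :
    (((finRotate (n + 1)) ^ m) i : ℕ) = (i + m) % (n + 1) := by
  induction m with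
  | zero => simp [Nat.mod_eq_of_lt i.2]
  | succ m ih =>
    rw [pow_succ', Equiv.Perm.mul_apply, finRotate_apply, Fin.val_add, ih, Fin.val_one',
      ← Nat.add_mod, add_assoc]

/-- The enumeration of `Fin d ⊕ Fin (N + 1)` by `Fin (d + (N + 1))` in which the right summand comes
first; it is `finSumFinEquiv` followed by a rotation, which makes its sign computable. -/
def sumEquivRotated (d N : ℕ) : Fin d ⊕ Fin (N + 1) ≃ Fin (d + (N + 1)) :=
  finSumFinEquiv.trans (finRotate (d + N + 1) ^ (N + 1))

lemma val_sumEquivRotated_inl {d : ℕ} (N : ℕ) (i : Fin d) :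
    (sumEquivRotated d N (Sum.inl i) : ℕ) = N + 1 + i := by
  have hi := i.isLt
  rw [sumEquivRotated, Equiv.trans_apply, val_finRotate_pow_apply, finSumFinEquiv_apply_left,
    Fin.val_castAdd, Nat.mod_eq_of_lt (by omega), add_comm]

lemma val_sumEquivRotated_inr (d : ℕ) {N : ℕ} (a : Fin (N + 1)) :
    (sumEquivRotated d N (Sum.inr a) : ℕ) = a := by
  have ha := a.isLt
  rw [sumEquivRotated, Equiv.trans_apply, val_finRotate_pow_apply, finSumFinEquiv_apply_right,
    Fin.val_natAdd, show d + a + (N + 1) = a + (d + N + 1) by omega, Nat.add_mod_right,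
    Nat.mod_eq_of_lt (by omega)]

lemma det_submatrix_sumEquivRotated {d N : ℕ}
    (A : Matrix (Fin (d + (N + 1))) (Fin (d + (N + 1))) R) :
    (A.submatrix finSumFinEquiv (sumEquivRotated d N)).det = (-1) ^ (d * (N + 1)) * A.det := by
  have hperm : (sumEquivRotated d N).symm.trans finSumFinEquiv =
      (finRotate (d + N + 1) ^ (N + 1))⁻¹ := by
    ext a
    simp [sumEquivRotated]
  have hsign : Equiv.Perm.sign ((finRotate (d + N + 1) ^ (N + 1))⁻¹) = (-1) ^ (d * (N + 1)) := by
    rw [Equiv.Perm.sign_inv, map_pow, sign_finRotate, ← pow_mul, Nat.add_sub_cancel, add_mul,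
      pow_add, (Nat.even_mul_succ_self N).neg_one_pow, mul_one]
  rw [det_submatrix_equiv_equiv, hperm]
  refine (congrArg (fun u : ℤˣ => ((u : ℤ) : R) * A.det) hsign).trans ?_
  simp

/-- The Jacobi–Trudi matrix of the shape `(N ^ d, N - q) / (N - p)`, transposed, for the power
series `h` in place of the generating function of the complete homogeneous polynomials. -/
noncomputable def jacobiTrudi (h : R⟦X⟧) (d : ℕ) {N : ℕ} (p q : Fin (N + 1)) :
    Matrix (Fin (d + 1)) (Fin (d + 1)) R :=
  of fun a b =>
    coeff (Fin.cons (α := fun _ => ℕ) (p : ℕ) (fun i : Fin d => N + 1 + i) a)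
      (X ^ Fin.snoc (α := fun _ => ℕ) (fun i : Fin d => (i : ℕ)) (d + q) b * h)

lemma det_jacobiTrudi_rescale_neg_one (h : R⟦X⟧) (d : ℕ) {N : ℕ} (p q : Fin (N + 1)) :
    (jacobiTrudi (rescale (-1) h) d p q).det =
      (-1) ^ (p + q + d * (N + 2) : ℕ) * (jacobiTrudi h d p q).det := by
  simp only [jacobiTrudi, coeff_X_pow_mul_rescale_neg_one]
  refine (det_neg_one_pow_add_mul _ _ _).trans ?_
  congr 1
  have hsum : ∑ a, Fin.cons (α := fun _ => ℕ) (p : ℕ) (fun i : Fin d => N + 1 + i) a +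
      ∑ b, Fin.snoc (α := fun _ => ℕ) (fun i : Fin d => (i : ℕ)) (d + q) b =
        p + q + d * (N + 2) + 2 * ∑ i : Fin d, (i : ℕ) := by
    rw [Fin.sum_univ_succ, Fin.sum_univ_castSucc]
    simp only [Fin.cons_zero, Fin.cons_succ, Fin.snoc_castSucc, Fin.snoc_last, sum_add_distrib,
      sum_const, card_univ, Fintype.card_fin, smul_eq_mul]
    ring
  rw [hsum, pow_add, pow_mul _ 2]
  simp

lemma det_submatrix_sumMap_toeplitz (f : R⟦X⟧) {N d : ℕ} (p q : Fin (N + 1)) :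
    (((toeplitz f 0 (d + (N + 1))).submatrix (sumEquivRotated d N) finSumFinEquiv).submatrix
      (Sum.map id fun _ : Fin 1 => p) (Sum.map id fun _ : Fin 1 => q)).det =
        (-1) ^ d * (jacobiTrudi f d p q).det := by
  have hsub : ((toeplitz f 0 (d + (N + 1))).submatrix (sumEquivRotated d N)
      finSumFinEquiv).submatrix (Sum.map id fun _ : Fin 1 => p) (Sum.map id fun _ : Fin 1 => q) =
        (jacobiTrudi f d p q).submatrix (finSumFinEquiv.trans (finRotate (d + 1)))
          finSumFinEquiv := by
    have col_inl (b : Fin d) : Fin.castAdd 1 b = b.castSucc := rfl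
    have col_inr (b : Fin 1) : Fin.natAdd d b = Fin.last d := by
      rw [Subsingleton.elim b 0]
      rfl
    ext (a | a) (b | b) <;>
      simp [jacobiTrudi, toeplitz_apply, val_sumEquivRotated_inl, val_sumEquivRotated_inr, col_inl,
        col_inr]
  rw [hsub, det_submatrix_equiv_equiv, ← Equiv.trans_assoc, Equiv.symm_trans_self,
    Equiv.refl_trans, sign_finRotate]
  simp

/-- The dual Jacobi–Trudi (Nägelsbach–Kostka) identity for the shape `(N ^ d, N - q) / (N - p)`. -/
theorem det_jacobiTrudi {e h : R⟦X⟧} (heh : e * rescale (-1) h = 1)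
    (he : constantCoeff e = 1) {N d : ℕ} (hunit : IsUnit (toeplitz e d (N + 1)).det)
    (p q : Fin (N + 1)) :
    (jacobiTrudi h d p q).det = ((toeplitz e d (N + 1)).submatrix q.succAbove p.succAbove).det := by
  set A := (toeplitz e 0 (d + (N + 1))).submatrix finSumFinEquiv (sumEquivRotated d N) with hA
  set B := (toeplitz (rescale (-1) h) 0 (d + (N + 1))).submatrix (sumEquivRotated d N)
    finSumFinEquiv with hB
  have hAB : A * B = 1 := by
    rw [hA, hB, submatrix_mul_equiv, toeplitz_mul_toeplitz_eq_one heh, submatrix_one_equiv]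
  have hblock : A.toBlocks₂₂ = toeplitz e d (N + 1) := by
    ext a b
    simp [A, toBlocks₂₂, toeplitz_apply, val_sumEquivRotated_inr]
  have hdetA : A.det = (-1) ^ (d * (N + 1)) := by
    rw [hA, det_submatrix_sumEquivRotated, det_toeplitz_zero, he, one_pow, mul_one]
  have hjacobi := det_mul_det_submatrix_sumMap hAB (hblock ▸ hunit) (fun _ : Fin 1 => p)
    (fun _ : Fin 1 => q)
  rw [hdetA, hB, det_submatrix_sumMap_toeplitz, det_jacobiTrudi_rescale_neg_one, hblock,
    det_fin_one, submatrix_apply, ← smul_eq_mul (toeplitz e d (N + 1)).det, ← Matrix.smul_apply,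
    ← adjugate_eq_det_smul_inv hunit] at hjacobi
  rw [det_submatrix_succAbove, ← hjacobi]
  simp only [← mul_assoc, ← pow_add]
  rw [Even.neg_one_pow ⟨p + q + d * (N + 2), by ring⟩, one_mul]

end DualJacobiTrudi

section SkewSchur

open Matrix PowerSeries Finset

lemma eval_one_hsymm (σ R : Type*) [CommRing R] [Fintype σ] [DecidableEq σ] (n : ℕ) :
    MvPolynomial.eval (fun _ : σ => (1 : R)) (MvPolynomial.hsymm σ R n) =
      (Fintype.card σ).multichoose n := by
  simp [MvPolynomial.hsymm, map_multiset_prod, Multiset.map_map, Sym.card_sym_eq_multichoose]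

lemma eval_one_completeHomogeneous (σ R : Type*) [CommRing R] [Fintype σ] [DecidableEq σ]
    (m b : ℕ) :
    MvPolynomial.eval (fun _ : σ => (1 : R)) (completeHomogeneous σ R (m - b)) =
      coeff m (X ^ b * (invOneSubPow R (Fintype.card σ)).val) := by
  rw [completeHomogeneous, coeff_X_pow_mul', coeff_invOneSubPow, apply_ite (MvPolynomial.eval _),
    eval_one_hsymm, map_zero, Int.toNat_sub]
  exact if_congr (by omega) rfl rfl

lemma getD_rectWithRow_castSucc (N j : ℕ) {d : ℕ} (a : Fin d) :
    (rectWithRow N d j).getD a 0 = N := by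
  rw [rectWithRow, List.getD_append _ _ _ _ (by simp), List.getD_replicate _ a.isLt]

lemma getD_rectWithRow_last (N d j : ℕ) : (rectWithRow N d j).getD d 0 = j := by
  simp [rectWithRow]

lemma eval_one_skewSchur_eq_det_jacobiTrudi (σ R : Type*) [CommRing R] [Fintype σ] [DecidableEq σ]
    (d : ℕ) {N : ℕ} (j k : Fin (N + 1)) :
    MvPolynomial.eval (fun _ : σ => (1 : R)) (skewSchur σ R (rectWithRow N d j) [(k : ℕ)]) =
      (jacobiTrudi (invOneSubPow R (Fintype.card σ)).val d k.rev j.rev).det := by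
  have hlen : max (rectWithRow N d j).length [(k : ℕ)].length = d + 1 := by simp [rectWithRow]
  rw [skewSchur, RingHom.map_det, ← det_submatrix_equiv_self (finCongr hlen).symm, ← det_transpose]
  congr 1
  have hj := j.is_le
  have hk := k.is_le
  ext b a
  simp only [transpose_apply, submatrix_apply, RingHom.mapMatrix_apply, map_apply, of_apply,
    jacobiTrudi, finCongr_symm, finCongr_apply, Fin.val_cast, ← eval_one_completeHomogeneous]
  congr 2
  refine Fin.lastCases ?_ (fun a => ?_) a <;> refine Fin.cases ?_ (fun b => ?_) b <;>
    simp only [Fin.val_castSucc, Fin.val_last, Fin.val_succ, Fin.val_zero, Fin.val_rev,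
      Fin.cons_zero, Fin.cons_succ, Fin.snoc_castSucc, Fin.snoc_last, getD_rectWithRow_castSucc,
      getD_rectWithRow_last, List.getD_cons_zero, List.getD_cons_succ, List.getD_nil] <;>
    omega

theorem eval_one_skewSchur_eq_toeplitzMinor (K : Type*) [Field K] [CharZero K] (g d : ℕ) {N : ℕ}
    (j k : Fin (N + 1)) :
    MvPolynomial.eval (fun _ : Fin (g + d) => (1 : K))
        (skewSchur (Fin (g + d)) K (rectWithRow N d j) [(k : ℕ)]) =
      toeplitzMinor K g d j k := by
  rw [eval_one_skewSchur_eq_det_jacobiTrudi, Fintype.card_fin,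
    det_jacobiTrudi (one_add_X_pow_mul_rescale_invOneSubPow (g + d)) (by simp)
      (isUnit_det_toeplitz_one_add_X_pow K g d (N + 1)), toeplitzMinor]

end SkewSchur

section Alternant

open Matrix Finset

variable {R : Type*} [CommRing R] {N : ℕ}

lemma det_vandermonde_cons (x : R) (z : Fin N → R) :
    (vandermonde (Fin.cons x z)).det = (∏ l, (z l - x)) * (vandermonde z).det := by
  rw [det_vandermonde, det_vandermonde]
  simp [Fin.prod_univ_succ, Fin.prod_Ioi_succ]

lemma det_vandermonde_cons_eq_sum (x : R) (z : Fin N → R) :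
    (vandermonde (Fin.cons x z)).det =
      ∑ i : Fin (N + 1),
        (of fun m l : Fin N => z l ^ (i.succAbove m : ℕ)).det * (-x) ^ (i : ℕ) := by
  rw [det_succ_row_zero]
  refine sum_congr rfl fun i _ => ?_
  have hminor : (vandermonde (Fin.cons x z)).submatrix Fin.succ i.succAbove =
      (of fun m l : Fin N => z l ^ (i.succAbove m : ℕ))ᵀ := rfl
  rw [hminor, det_transpose, vandermonde_apply, Fin.cons_zero, ← mul_pow, neg_one_mul, mul_comm]

theorem det_pow_succAbove (z : Fin N → R) (i : Fin (N + 1)) :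
    (of fun m l : Fin N => z l ^ (i.succAbove m : ℕ)).det =
      MvPolynomial.eval z (MvPolynomial.esymm (Fin N) R (N - i)) * (vandermonde z).det := by
  open Polynomial in
  have hmap (m : Fin (N + 1)) : (of fun a l : Fin N => C (z l) ^ (m.succAbove a : ℕ)).det =
      C (of fun a l : Fin N => z l ^ (m.succAbove a : ℕ)).det := by
    rw [RingHom.map_det]
    congr 1
    ext1 a l
    simp
  have hvandermonde : (vandermonde fun l => C (z l)).det = C (vandermonde z).det := by
    simp [det_vandermonde]
  have expand := (det_vandermonde_cons (-X) fun l => C (z l)).symm.trans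
    (det_vandermonde_cons_eq_sum (-X) fun l => C (z l))
  simp only [hmap, hvandermonde, neg_neg, sub_neg_eq_add] at expand
  have hcoeff := congrArg (coeff · (i : ℕ)) expand
  simp only [finsetSum_coeff, coeff_C_mul, coeff_mul_C, coeff_X_pow, Fin.val_inj, mul_ite, mul_one,
    mul_zero, sum_ite_eq, mem_univ, if_true] at hcoeff
  simp only [add_comm (C _), prod_X_add_C_coeff _ _ (i.is_le.trans_eq (card_fin N).symm),
    card_fin] at hcoeff
  rw [← hcoeff, MvPolynomial.esymm]
  simp

lemma prod_norm_sub_sq {𝕜 : Type*} [RCLike 𝕜] (z : Fin N → 𝕜) :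
    ((∏ p : Fin N × Fin N with p.1 < p.2, ‖z p.1 - z p.2‖ ^ 2 : ℝ) : 𝕜) =
      (vandermonde z).det * (vandermonde fun l => star (z l)).det := by
  rw [det_vandermonde, det_vandermonde, ← prod_mul_distrib, prod_filter, Fintype.prod_prod_type,
    RCLike.ofReal_prod]
  refine prod_congr rfl fun a _ => ?_
  rw [← prod_filter, filter_lt_eq_Ioi, ← prod_mul_distrib, RCLike.ofReal_prod]
  refine prod_congr rfl fun b _ => ?_
  rw [← star_sub, norm_sub_rev, RCLike.star_def, RCLike.mul_conj, RCLike.ofReal_pow]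

end Alternant

section Andreief

open MeasureTheory Matrix Finset

lemma det_mul_prod {ι R : Type*} [Fintype ι] [DecidableEq ι] [CommRing R] (A : Matrix ι ι R)
    (w : ι → R) :
    A.det * ∏ l, w l =
      ∑ σ : Equiv.Perm ι, (Equiv.Perm.sign σ : R) * ∏ l, A (σ l) l * w l := by
  rw [det_apply', sum_mul]
  simp only [mul_assoc, prod_mul_distrib]

variable {α ι 𝕜 : Type*} [MeasurableSpace α] [Fintype ι] [DecidableEq ι] [RCLike 𝕜]
  {μ : Measure α} [SigmaFinite μ] {F G : ι → α → 𝕜}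

lemma integrable_det_mul_prod (hFG : ∀ a b, Integrable (fun x => F a x * G b x) μ) :
    Integrable (fun θ => (of fun m l => F m (θ l)).det * ∏ l, G l (θ l))
      (Measure.pi fun _ : ι => μ) := by
  simp only [det_mul_prod, of_apply]
  exact integrable_finsetSum _ fun σ _ => (Integrable.fintype_prod
    (f := fun l x => F (σ l) x * G l x) fun l => hFG (σ l) l).const_mul _

lemma integral_det_mul_prod (hFG : ∀ a b, Integrable (fun x => F a x * G b x) μ) :
    ∫ θ, (of fun m l => F m (θ l)).det * ∏ l, G l (θ l) ∂(Measure.pi fun _ : ι => μ) =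
      (of fun a b => ∫ x, F a x * G b x ∂μ).det := by
  simp only [det_mul_prod, of_apply]
  rw [integral_finsetSum _ fun σ _ => (Integrable.fintype_prod
    (f := fun l x => F (σ l) x * G l x) fun l => hFG (σ l) l).const_mul _, det_apply']
  refine sum_congr rfl fun σ _ => ?_
  rw [integral_const_mul, integral_fintype_prod_eq_prod (f := fun l x => F (σ l) x * G l x)]
  rfl

theorem integral_det_mul_det (hFG : ∀ a b, Integrable (fun x => F a x * G b x) μ) :
    ∫ θ, (of fun m l => F m (θ l)).det * (of fun m l => G m (θ l)).det
        ∂(Measure.pi fun _ : ι => μ) =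
      (Fintype.card ι).factorial * (of fun a b => ∫ x, F a x * G b x ∂μ).det := by
  have expand (θ : ι → α) : (of fun m l => F m (θ l)).det * (of fun m l => G m (θ l)).det =
      ∑ τ : Equiv.Perm ι, (Equiv.Perm.sign τ : 𝕜) *
        ((of fun m l => F m (θ l)).det * ∏ l, G (τ l) (θ l)) := by
    rw [det_apply' (of fun m l => G m (θ l)), mul_sum]
    exact sum_congr rfl fun τ _ => mul_left_comm _ _ _
  have term (τ : Equiv.Perm ι) : (Equiv.Perm.sign τ : 𝕜) *
      ∫ θ, (of fun m l => F m (θ l)).det * ∏ l, G (τ l) (θ l) ∂(Measure.pi fun _ : ι => μ) =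
        (of fun a b => ∫ x, F a x * G b x ∂μ).det := by
    have hsign : (Equiv.Perm.sign τ : 𝕜) * (Equiv.Perm.sign τ : 𝕜) = 1 := by
      rw [← Int.cast_mul, ← Units.val_mul, Int.units_mul_self, Units.val_one, Int.cast_one]
    have hperm := (integral_det_mul_prod fun a b => hFG a (τ b)).trans
      (det_permute' τ (of fun a b => ∫ x, F a x * G b x ∂μ))
    rw [hperm, ← mul_assoc, hsign, one_mul]
  simp only [expand]
  rw [integral_finsetSum _ fun τ _ =>
    (integrable_det_mul_prod fun a b => hFG a (τ b)).const_mul _]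
  simp only [integral_const_mul, term, sum_const, card_univ, Fintype.card_perm, nsmul_eq_mul]

end Andreief

section Morris

open MeasureTheory Matrix Finset Complex

lemma volume_restrict_Icc_pi {ι : Type*} [Fintype ι] (a b : ι → ℝ) :
    (volume : Measure (ι → ℝ)).restrict (Set.Icc a b) =
      Measure.pi fun i => (volume : Measure ℝ).restrict (Set.Icc (a i) (b i)) := by
  rw [← Set.pi_univ_Icc, volume_pi, Measure.restrict_pi_pi]

lemma one_add_exp_I_mul (θ : ℝ) :
    1 + exp (I * θ) = exp (I * θ / 2) * (2 * Real.cos (θ / 2) : ℝ) := by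
  rw [ofReal_mul, ofReal_cos, ofReal_ofNat, two_cos, mul_add, ← exp_add, ← exp_add, add_comm,
    ← exp_zero]
  push_cast
  ring_nf

lemma morrisWeight_eq (g d : ℕ) {θ : ℝ} (hθ : θ ∈ Set.Icc (-Real.pi) Real.pi) :
    morrisWeight g d θ = exp (-(I * θ)) ^ d * (1 + exp (I * θ)) ^ (g + d) := by
  have hcos : 0 ≤ Real.cos (θ / 2) :=
    Real.cos_nonneg_of_mem_Icc ⟨by linarith [hθ.1], by linarith [hθ.2]⟩
  have hnorm : ‖1 + exp (I * θ)‖ = 2 * Real.cos (θ / 2) := by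
    have hhalf : I * θ / 2 = I * (θ / 2 : ℝ) := by push_cast; ring
    rw [one_add_exp_I_mul, norm_mul, hhalf, norm_exp_I_mul_ofReal, one_mul, norm_real,
      Real.norm_of_nonneg (by positivity)]
  have hphase : exp (I * θ * ((g : ℂ) - d) / 2) =
      exp (-(I * θ)) ^ d * exp (I * θ / 2) ^ (g + d) := by
    rw [← exp_nat_mul, ← exp_nat_mul, ← exp_add]
    push_cast
    ring_nf
  rw [morrisWeight, hnorm, one_add_exp_I_mul, mul_pow (exp _), hphase, ofReal_pow, mul_assoc]

lemma continuous_morrisWeight (g d : ℕ) : Continuous (morrisWeight g d) := by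
  unfold morrisWeight
  fun_prop

lemma integral_exp_pow_mul_exp_neg_pow (m n : ℕ) :
    ∫ θ in Set.Icc (-Real.pi) Real.pi, exp (I * θ) ^ m * exp (-(I * θ)) ^ n =
      if m = n then 2 * (Real.pi : ℂ) else 0 := by
  have hexp (θ : ℝ) : exp (I * θ) ^ m * exp (-(I * θ)) ^ n = exp (I * (m - n : ℤ) * θ) := by
    rw [← exp_nat_mul, ← exp_nat_mul, ← exp_add]
    push_cast
    ring_nf
  rw [integral_Icc_eq_integral_Ioc, ← intervalIntegral.integral_of_le (by linarith [Real.pi_pos])]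
  simp only [hexp]
  split_ifs with hmn
  · subst hmn
    simp [two_mul]
  · have hc : I * (m - n : ℤ) ≠ 0 := mul_ne_zero I_ne_zero (Int.cast_ne_zero.2 (by omega))
    have hperiod : exp (I * (m - n : ℤ) * Real.pi) = exp (I * (m - n : ℤ) * (-Real.pi : ℝ)) :=
      exp_eq_exp_iff_exists_int.2 ⟨m - n, by push_cast; ring⟩
    rw [integral_exp_mul_complex hc, hperiod, sub_self, zero_div]

lemma integral_eval_exp_mul_exp_neg_pow (P : Polynomial ℂ) (n : ℕ) :
    ∫ θ in Set.Icc (-Real.pi) Real.pi, P.eval (exp (I * θ)) * exp (-(I * θ)) ^ n =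
      2 * (Real.pi : ℂ) * P.coeff n := by
  have hint (Q : Polynomial ℂ) :
      IntegrableOn (fun θ : ℝ => Q.eval (exp (I * θ)) * exp (-(I * θ)) ^ n)
        (Set.Icc (-Real.pi) Real.pi) :=
    Continuous.integrableOn_Icc (by fun_prop)
  induction P using Polynomial.induction_on' with
  | add P Q hP hQ =>
    simp only [Polynomial.eval_add, add_mul, Polynomial.coeff_add, mul_add]
    rw [integral_add (hint P) (hint Q), hP, hQ]
  | monomial m c =>
    simp only [Polynomial.eval_monomial, mul_assoc, integral_const_mul,
      integral_exp_pow_mul_exp_neg_pow, Polynomial.coeff_monomial]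
    split_ifs <;> ring

lemma integral_morrisWeight (g d : ℕ) {n : ℕ} (a b : Fin n) :
    ∫ θ in Set.Icc (-Real.pi) Real.pi,
        morrisWeight g d θ * exp (-(I * θ)) ^ (a : ℕ) * exp (I * θ) ^ (b : ℕ) =
      2 * (Real.pi : ℂ) * toeplitz ((1 + PowerSeries.X) ^ (g + d)) d n a b := by
  have hcoeff : (Polynomial.X ^ (b : ℕ) * (1 + Polynomial.X) ^ (g + d) : Polynomial ℂ).coeff
      (d + a) = toeplitz ((1 + PowerSeries.X) ^ (g + d)) d n a b := by
    rw [toeplitz_apply, ← Polynomial.coeff_coe]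
    simp
  rw [← hcoeff, ← integral_eval_exp_mul_exp_neg_pow]
  refine setIntegral_congr_fun measurableSet_Icc fun θ hθ => ?_
  simp only [morrisWeight_eq g d hθ, Polynomial.eval_mul, Polynomial.eval_pow, Polynomial.eval_add,
    Polynomial.eval_X, Polynomial.eval_one, pow_add]
  ring

lemma morrisIntegrand_eq_det_mul_det (g d : ℕ) {N : ℕ} (j k : Fin (N + 1)) (θ : Fin N → ℝ) :
    MvPolynomial.eval (fun l => exp (I * (θ l : ℂ))) (MvPolynomial.esymm (Fin N) ℂ k) *
        MvPolynomial.eval (fun l => exp (-(I * (θ l : ℂ)))) (MvPolynomial.esymm (Fin N) ℂ j) *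
        (∏ l : Fin N, morrisWeight g d (θ l)) *
        ((∏ p : Fin N × Fin N with p.1 < p.2,
          ‖exp (I * (θ p.1 : ℂ)) - exp (I * (θ p.2 : ℂ))‖ ^ 2 : ℝ) : ℂ) =
      (of fun m l : Fin N =>
          morrisWeight g d (θ l) * exp (-(I * (θ l : ℂ))) ^ (j.rev.succAbove m : ℕ)).det *
        (of fun m l : Fin N => exp (I * (θ l : ℂ)) ^ (k.rev.succAbove m : ℕ)).det := by
  have hstar (l : Fin N) : star (exp (I * (θ l : ℂ))) = exp (-(I * (θ l : ℂ))) := by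
    rw [star_def, ← exp_conj]
    simp
  have hrev (i : Fin (N + 1)) : N - (i.rev : ℕ) = i := by
    have hi := i.is_le
    rw [Fin.val_rev]
    omega
  have hweight := det_mul_row (fun l => morrisWeight g d (θ l))
    (of fun m l : Fin N => exp (-(I * (θ l : ℂ))) ^ (j.rev.succAbove m : ℕ))
  have hvandermonde := prod_norm_sub_sq (𝕜 := ℂ) fun l => exp (I * (θ l : ℂ))
  simp only [of_apply] at hweight
  rw [hweight, det_pow_succAbove (fun l => exp (-(I * (θ l : ℂ)))),
    det_pow_succAbove (fun l => exp (I * (θ l : ℂ))), hrev, hrev]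
  refine (congrArg _ hvandermonde).trans ?_
  simp only [hstar]
  ring

theorem morrisIntegral_eq_toeplitzMinor (g d : ℕ) {N : ℕ} (j k : Fin (N + 1)) :
    morrisIntegral N g d k j = toeplitzMinor ℂ g d j k := by
  have hmoments : (of fun a b : Fin N => ∫ x in Set.Icc (-Real.pi) Real.pi,
      morrisWeight g d x * exp (-(I * (x : ℂ))) ^ (j.rev.succAbove a : ℕ) *
        exp (I * (x : ℂ)) ^ (k.rev.succAbove b : ℕ)) =
      (2 * (Real.pi : ℂ)) • (toeplitz ((1 + PowerSeries.X) ^ (g + d)) d (N + 1)).submatrix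
        j.rev.succAbove k.rev.succAbove := by
    ext a b
    exact integral_morrisWeight g d _ _
  have hweight := continuous_morrisWeight g d
  have hfactorial : (N.factorial : ℂ) ≠ 0 := Nat.cast_ne_zero.2 N.factorial_ne_zero
  rw [morrisIntegral]
  simp only [morrisIntegrand_eq_det_mul_det]
  rw [volume_restrict_Icc_pi, integral_det_mul_det
    (F := fun m x => morrisWeight g d x * exp (-(I * (x : ℂ))) ^ (j.rev.succAbove m : ℕ))
    (G := fun m x => exp (I * (x : ℂ)) ^ (k.rev.succAbove m : ℕ))
    fun a b => Continuous.integrableOn_Icc (by fun_prop), hmoments, det_smul, Fintype.card_fin,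
    ← toeplitzMinor]
  field_simp

end Morris

section Barnes

open PowerSeries Finset

lemma barnesG_one : barnesG 1 = 1 := by simp [barnesG]

lemma natCast_barnesG_ne_zero (K : Type*) [Field K] [CharZero K] (n : ℕ) : (barnesG n : K) ≠ 0 :=
  Nat.cast_ne_zero.2 (prod_ne_zero_iff.2 fun i _ => i.factorial_ne_zero)

lemma barnesG_add (m n : ℕ) :
    barnesG (m + n + 1) = barnesG (m + 1) * ∏ i ∈ range n, (m + i).factorial := by
  simp [barnesG, prod_range_add]

lemma barnesG_mul_barnesG_mul_prod_ascFactorial (m d g : ℕ) :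
    barnesG (m + d + 1) * barnesG (m + g + 1) * ∏ i ∈ range d, (m + i + 1).ascFactorial g =
      barnesG (m + 1) * barnesG (m + g + d + 1) := by
  have hprod : (∏ i ∈ range d, (m + i).factorial) * ∏ i ∈ range d, (m + i + 1).ascFactorial g =
      ∏ i ∈ range d, (m + g + i).factorial := by
    simp only [← prod_mul_distrib, Nat.factorial_mul_ascFactorial, add_right_comm m _ g]
  rw [barnesG_add m d, barnesG_add (m + g) d, ← hprod]
  ring

lemma det_ascDiagonal_eq_barnesG_div (K : Type*) [Field K] [CharZero K] (m n : ℕ) :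
    (ascDiagonal K m n).det =
      (barnesG (m + n + 1) : K) / (barnesG (n + 1) * barnesG (m + 1)) := by
  have hG := natCast_barnesG_ne_zero K
  rw [det_ascDiagonal, eq_div_iff (mul_ne_zero (hG _) (hG _)), mul_comm]
  have hprod := barnesG_mul_barnesG_mul_prod_ascFactorial 0 n m
  simp only [zero_add, barnesG_one, one_mul] at hprod
  exact_mod_cast hprod

theorem det_toeplitz_one_add_X_pow (K : Type*) [Field K] [CharZero K] (g d n : ℕ) :
    (toeplitz ((1 + X : K⟦X⟧) ^ (g + d)) d n).det =
      (barnesG (d + 1) : K) * barnesG (g + 1) / barnesG (g + d + 1) *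
        ∏ i ∈ range d, ((n + i + 1).ascFactorial g : K) := by
  have hG := natCast_barnesG_ne_zero K
  have hdet := det_ascDiagonal_mul_det_toeplitz K g d n
  have hprod : ∏ i ∈ range d, ((n + i + 1).ascFactorial g : K) =
      barnesG (n + 1) * barnesG (n + g + d + 1) / (barnesG (n + d + 1) * barnesG (n + g + 1)) := by
    rw [eq_div_iff (mul_ne_zero (hG _) (hG _)), mul_comm]
    exact_mod_cast barnesG_mul_barnesG_mul_prod_ascFactorial n d g
  simp only [det_ascDiagonal_eq_barnesG_div, add_comm _ n, ← add_assoc] at hdet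
  rw [hprod]
  field_simp [hG] at hdet ⊢
  linear_combination hdet

end Barnes

section Asymptotics

open PowerSeries Finset

variable (𝕜 : Type*) [RCLike 𝕜]

lemma tendsto_norm_natCast_atTop : Tendsto (fun N : ℕ => ‖(N : 𝕜)‖) atTop atTop :=
  tendsto_norm_cobounded_atTop.comp tendsto_natCast_atTop_cobounded

lemma isEquivalent_natCast_sub_add (a b : ℕ) :
    (fun N : ℕ => ((N - a + b : ℕ) : 𝕜)) ~[atTop] fun N => (N : 𝕜) := by
  refine (IsEquivalent.refl.add_const_of_norm_tendsto_atTop (c := (b - a : 𝕜))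
    (tendsto_norm_natCast_atTop 𝕜)).congr_left ?_
  filter_upwards [eventually_ge_atTop a] with N hN
  push_cast [hN]
  ring

variable {𝕜}

lemma isEquivalent_ascFactorial {s : ℕ → ℕ} (hs : (fun N => (s N : 𝕜)) ~[atTop] fun N => (N : 𝕜))
    (g : ℕ) : (fun N => ((s N).ascFactorial g : 𝕜)) ~[atTop] fun N => (N : 𝕜) ^ g := by
  have hprod := IsEquivalent.finsetProd (s := range g) (l := atTop)
    (f := fun i N => ((s N + i : ℕ) : 𝕜)) (g := fun _ N => (N : 𝕜)) fun i _ => by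
      simpa only [Nat.cast_add] using
        hs.add_const_of_norm_tendsto_atTop (c := (i : 𝕜)) (tendsto_norm_natCast_atTop 𝕜)
  simpa only [Nat.ascFactorial_eq_prod_range, Nat.cast_prod, prod_const, card_range] using hprod

lemma isEquivalent_sum_natCast_mul {ι α : Type*} {l : Filter α} {s : Finset ι} {c : ι → ℕ}
    {u : ι → α → 𝕜} (hu : ∀ i ∈ s, u i ~[l] fun _ => 1) :
    (fun x => ∑ i ∈ s, u i x * c i) ~[l] fun _ => ∑ i ∈ s, (c i : 𝕜) := by
  by_cases hc : ∑ i ∈ s, c i = 0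
  · have hzero : ∀ i ∈ s, c i = 0 := fun i hi => sum_eq_zero_iff.1 hc i hi
    rw [sum_congr rfl fun i hi => by rw [hzero i hi, Nat.cast_zero], sum_const_zero]
    refine (EventuallyEq.of_eq (funext fun x => ?_)).isEquivalent
    exact sum_eq_zero fun i hi => by rw [hzero i hi, Nat.cast_zero, mul_zero]
  · have hcast : ∑ i ∈ s, (c i : 𝕜) ≠ 0 := by exact_mod_cast hc
    refine (isEquivalent_const_iff_tendsto hcast).2 (tendsto_finsetSum _ fun i hi => ?_)
    simpa only [one_mul] using
      ((isEquivalent_const_iff_tendsto one_ne_zero).1 (hu i hi)).mul_const (c i : 𝕜)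

variable (𝕜)

lemma isEquivalent_det_toeplitz_one_add_X_pow (g d : ℕ) :
    (fun N : ℕ => (toeplitz ((1 + X : 𝕜⟦X⟧) ^ (g + d)) d (N + 1)).det) ~[atTop] fun N =>
      (N : 𝕜) ^ (d * g) * ((barnesG (d + 1) : 𝕜) * barnesG (g + 1) / barnesG (g + d + 1)) := by
  have hprod := IsEquivalent.finsetProd (s := range d) (l := atTop)
    (f := fun i N => ((N + 1 + i + 1 : ℕ).ascFactorial g : 𝕜)) (g := fun _ N => (N : 𝕜) ^ g)
    fun i _ => isEquivalent_ascFactorial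
      (by simpa only [tsub_zero, ← add_assoc] using isEquivalent_natCast_sub_add 𝕜 0 (1 + i + 1)) g
  simp only [prod_const, card_range, ← pow_mul, mul_comm g d] at hprod
  simp only [det_toeplitz_one_add_X_pow, mul_comm (_ / _)]
  exact hprod.mul IsEquivalent.refl

lemma isEquivalent_ascFactorial_mul_div_one (g d j k r : ℕ) :
    (fun N : ℕ => ((N - k + 1 : ℕ).ascFactorial g : 𝕜) * (N - j + 1 : ℕ).ascFactorial d /
      (N - r + 1).ascFactorial (g + d)) ~[atTop] fun _ => 1 := by
  have hasc (a m : ℕ) := isEquivalent_ascFactorial (isEquivalent_natCast_sub_add 𝕜 a 1) m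
  refine (((hasc k g).mul (hasc j d)).div (hasc r (g + d))).congr_right ?_
  filter_upwards [eventually_ne_atTop 0] with N hN
  have hpow : (N : 𝕜) ^ (g + d) ≠ 0 := pow_ne_zero _ (Nat.cast_ne_zero.2 hN)
  simp only [Pi.div_apply, Pi.mul_apply, ← pow_add, div_self hpow]

lemma eventually_val_finOfNat (i : ℕ) : ∀ᶠ N in atTop, (Fin.ofNat (N + 1) i : ℕ) = i := by
  filter_upwards [eventually_ge_atTop i] with N hN
  rw [Fin.val_ofNat, Nat.mod_eq_of_lt (Nat.lt_succ_of_le hN)]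

theorem isEquivalent_toeplitzMinor (g d j k : ℕ) :
    (fun N : ℕ => toeplitzMinor 𝕜 g d (Fin.ofNat (N + 1) j) (Fin.ofNat (N + 1) k)) ~[atTop]
      fun N => (N : 𝕜) ^ (d * g) *
        ((barnesG (d + 1) : 𝕜) * barnesG (g + 1) / barnesG (g + d + 1)) *
          ∑ r ∈ range (min j k + 1), (g.multichoose (j - r) : 𝕜) * d.multichoose (k - r) := by
  have hsum := isEquivalent_sum_natCast_mul (s := range (min j k + 1))
    (c := fun r => g.multichoose (j - r) * d.multichoose (k - r))
    fun r _ => isEquivalent_ascFactorial_mul_div_one 𝕜 g d j k r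
  push_cast at hsum
  refine ((isEquivalent_det_toeplitz_one_add_X_pow 𝕜 g d).mul hsum).congr_left ?_
  filter_upwards [eventually_val_finOfNat j, eventually_val_finOfNat k] with N hj hk
  rw [toeplitzMinor_eq_det_mul_sum, hj, hk]
  rfl

end Asymptotics

end SkewSchurAsymptotics

open SkewSchurAsymptotics in
theorem mainTheorem10_general (M d j k : ℕ) (hd : d ≤ M) :
    (fun N : ℕ => MvPolynomial.eval (fun _ : Fin M => (1 : ℝ))
        (skewSchur (Fin M) ℝ (rectWithRow N d j) [k]))
      ~[atTop]
      (fun N : ℕ => (N : ℝ) ^ (d * (M - d)) *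
        ((barnesG (d + 1) : ℝ) * barnesG (M - d + 1) / barnesG (M + 1)) *
        ∑ r ∈ Finset.range (min j k + 1),
          ((Ring.choose ((M : ℤ) - d + j - r - 1) (j - r) : ℤ) : ℝ) *
            ((Ring.choose ((d : ℤ) + k - r - 1) (k - r) : ℤ) : ℝ)) ∧
    (fun N : ℕ => morrisIntegral N (M - d) d k j)
      ~[atTop]
      (fun N : ℕ => (N : ℂ) ^ (d * (M - d)) *
        ((barnesG (d + 1) : ℂ) * barnesG (M - d + 1) / barnesG (M + 1)) *
        ∑ r ∈ Finset.range (min j k + 1),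
          ((Ring.choose ((M : ℤ) - d + j - r - 1) (j - r) : ℤ) : ℂ) *
            ((Ring.choose ((d : ℤ) + k - r - 1) (k - r) : ℤ) : ℂ)) := by
  obtain ⟨g, rfl⟩ := Nat.exists_eq_add_of_le' hd
  have hsum (𝕜 : Type) [RCLike 𝕜] : ∑ r ∈ Finset.range (min j k + 1),
      ((Ring.choose (((g + d : ℕ) : ℤ) - d + j - r - 1) (j - r) : ℤ) : 𝕜) *
        ((Ring.choose ((d : ℤ) + k - r - 1) (k - r) : ℤ) : 𝕜) =
      ∑ r ∈ Finset.range (min j k + 1), (g.multichoose (j - r) : 𝕜) * d.multichoose (k - r) := by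
    refine Finset.sum_congr rfl fun r hr => ?_
    rw [Nat.cast_add, add_sub_cancel_right, ringChoose_eq_multichoose g (by grind),
      ringChoose_eq_multichoose d (by grind), Int.cast_natCast, Int.cast_natCast]
  simp only [hsum ℝ, hsum ℂ, Nat.add_sub_cancel]
  constructor
  · refine (isEquivalent_toeplitzMinor ℝ g d j k).congr_left ?_
    filter_upwards [eventually_val_finOfNat j, eventually_val_finOfNat k] with N hj hk
    rw [← eval_one_skewSchur_eq_toeplitzMinor, hj, hk]
  · refine (isEquivalent_toeplitzMinor ℂ g d j k).congr_left ?_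
    filter_upwards [eventually_val_finOfNat j, eventually_val_finOfNat k] with N hj hk
    rw [← morrisIntegral_eq_toeplitzMinor, hj, hk]

theorem mainTheorem10 (M d j k : ℕ) (hd : 1 ≤ d) (hM : d < M ∨ (d = M ∧ j = 0)) :
    (fun N : ℕ => MvPolynomial.eval (fun _ : Fin M => (1 : ℝ))
        (SkewSchurAsymptotics.skewSchur (Fin M) ℝ
          (SkewSchurAsymptotics.rectWithRow N d j) [k]))
      ~[atTop]
      (fun N : ℕ => (N : ℝ) ^ (d * (M - d)) *
        ((SkewSchurAsymptotics.barnesG (d + 1) : ℝ) * SkewSchurAsymptotics.barnesG (M - d + 1) /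
          SkewSchurAsymptotics.barnesG (M + 1)) *
        ∑ r ∈ Finset.range (min j k + 1),
          ((Ring.choose ((M : ℤ) - d + j - r - 1) (j - r) : ℤ) : ℝ) *
            ((Ring.choose ((d : ℤ) + k - r - 1) (k - r) : ℤ) : ℝ)) ∧
    (fun N : ℕ => SkewSchurAsymptotics.morrisIntegral N (M - d) d k j)
      ~[atTop]
      (fun N : ℕ => (N : ℂ) ^ (d * (M - d)) *
        ((SkewSchurAsymptotics.barnesG (d + 1) : ℂ) * SkewSchurAsymptotics.barnesG (M - d + 1) /
          SkewSchurAsymptotics.barnesG (M + 1)) *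
        ∑ r ∈ Finset.range (min j k + 1),
          ((Ring.choose ((M : ℤ) - d + j - r - 1) (j - r) : ℤ) : ℂ) *
            ((Ring.choose ((d : ℤ) + k - r - 1) (k - r) : ℤ) : ℂ)) :=
  mainTheorem10_general M d j k (by omega)
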